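/- Let $\tau>0$, let $\lambda_0,\lambda\in L^\infty(\mathbb R)$ be real-valued, and let $\alpha_0>0$ satisfy $\lambda_0(x)\ge\alpha_0$ for a.e. $x\in\mathbb R$. Consider the linear delayed KdV–Burgers problem $$\begin{cases}u_t(x,t)+u_{xxx}(x,t)-u_{xx}(x,t)+\lambda_0(x)u(x,t)+\lambda(x)u(x,t-\tau)=0&\text{in }\mathbb R\times(0,\infty),\\ u(x,s)=u_0(x,s)&\text{in }\mathbb R\times[-\tau,0],\end{cases}\qquad(*)$$ with $u_0\in C([-\tau,0];L^2(\mathbb R))$, where $L^2(\mathbb R)$ is the space of real-valued square integrable functions. A solution of $(*)$ is a function $u\in C([-\tau,\infty);L^2(\mathbb R))$ with $u=u_0$ on $[-\tau,0]$ such that for every $\varphi\in C_c^\infty(\mathbb R)$ and every $t>0$ $$\frac{d}{dt}\int_{\mathbb R}u(t)\varphi\,dx=\int_{\mathbb R}u(t)\,(\varphi'''+\varphi'')\,dx-\int_{\mathbb R}\lambda_0u(t)\varphi\,dx-\int_{\mathbb R}\lambda\,u(t-\tau)\varphi\,dx .$$ Set $$\mathcal E(t)=\frac12\int_{\mathbb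 R}u^2(x,t)\,dx+\frac12\int_{t-\tau}^t\int_{\mathbb R}e^{-(t-s)}|\lambda(x)|\,u^2(x,s)\,dx\,ds,\qquad c_p=\Big(1-\frac1{2p}\Big)\Big(\frac2p\Big)^{\frac1{2p-1}}.$$ Suppose that for some real $1\le p<\infty$ there are a constant $\alpha$ and a real-valued function $\beta\in L^p(\mathbb R)$ such that $$\frac{e^\tau+1}2|\lambda(x)|\le\alpha+\beta(x)\ \text{ for a.e. }x\in\mathbb R,\qquad 0\le\alpha<\alpha_0,\qquad \|\beta\|_p<\Big(\frac{\alpha_0-\alpha}{c_p}\Big)^{1-\frac1{2p}} .$$ Then: 1. The problem $(*)$ is exponentially stable: there are constants $M,\delta>0$, independent of $u_0$, such that every solution satisfies $\|u(t)\|_2\le Me^{-\delta t}\max_{s\in[-\tau,0]}\|u_0(s)\|_2$ for all $t\ge0$. 2. The number $$\gamma=\min\Big\{2\Big(\alpha_0-\alpha-\frac{2p-1}{2p}\Big(\frac2p\Big)^{\frac1{2p-1}}\|\beta\|_p^{\frac{2p}{2p-1}}\Big),\,1\Big\}$$ is positive, and every solution satisfies, for all $t\ge0$, $$\mathcal E(t)\le\mathcal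 E(0)e^{-\gamma t}\qquad\text{and}\qquad \mathcal E(t)\le C(u_0)e^{-\gamma t},$$ where $$C(u_0)=\frac12\|u_0(0)\|_2^2+\int_{-\tau}^0\int_{\mathbb R}e^{s}|\lambda(x)|\,u_0^2(x,s)\,dx\,ds .$$ -/

import Mathlib

open MeasureTheory Set
open scoped ContDiff

namespace DelayedKdVBurgers

noncomputable section

/-- The real Hilbert space `H = L²(ℝ)` with Lebesgue measure. -/
abbrev L2 : Type := Lp ℝ 2 (volume : Measure ℝ)

/-- `u ∈ C([-τ, ∞); L²(ℝ))` solves the Cauchy problem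
`u_t + u_xxx - u_xx + l₀ u + l u(t - τ) = 0` in `ℝ × (0, ∞)`, `u = u₀` on `ℝ × [-τ, 0]`.
The equation is understood in the sense of distributions in `x`: for every test function
`φ ∈ C_c^∞(ℝ)` and every `t > 0`, after moving the space derivatives to `φ`,
`d/dt ∫ u φ = ∫ u φ''' + ∫ u φ'' - ∫ l₀ u φ - ∫ l u(t - τ) φ`. -/
structure IsSolution (τ : ℝ) (l₀ l : ℝ → ℝ) (u₀ u : ℝ → L2) : Prop where
  continuousOn : ContinuousOn u (Ici (-τ))
  initial : ∀ s ∈ Icc (-τ) 0, u s = u₀ s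
  equation : ∀ φ : ℝ → ℝ, ContDiff ℝ ∞ φ → HasCompactSupport φ → ∀ t : ℝ, 0 < t →
    HasDerivAt (fun r : ℝ => ∫ x, u r x * φ x)
      ((∫ x, u t x * iteratedDeriv 3 φ x) + (∫ x, u t x * iteratedDeriv 2 φ x)
        - (∫ x, l₀ x * u t x * φ x) - (∫ x, l x * u (t - τ) x * φ x)) t

/-- The Lyapunov functional
`½ ∫ u(x,t)² dx + ½ ∫_{t-τ}^t ∫ e^{-(t-s)} |l(x)| u(x,s)² dx ds`. -/
def lyapunov (τ : ℝ) (l : ℝ → ℝ) (u : ℝ → L2) (t : ℝ) : ℝ :=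
  1 / 2 * (∫ x, (u t x) ^ 2)
    + 1 / 2 * ∫ s in (t - τ)..t, ∫ x, Real.exp (-(t - s)) * |l x| * (u s x) ^ 2

/-- The constant `½ ‖u₀(0)‖² + ∫_{-τ}^0 ∫ e^s |l(x)| u₀(x,s)² dx ds`. -/
def initialConst (τ : ℝ) (l : ℝ → ℝ) (u₀ : ℝ → L2) : ℝ :=
  1 / 2 * ‖u₀ 0‖ ^ 2 + ∫ s in (-τ)..0, ∫ x, Real.exp s * |l x| * (u₀ s x) ^ 2

/-- The norm of `β` in `L^p(ℝ)`, for real `p`. -/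
def normLp (p : ℝ) (β : ℝ → ℝ) : ℝ :=
  (eLpNorm β (ENNReal.ofReal p) volume).toReal

/-- `c_p = (1 - 1/(2p)) (2/p)^{1/(2p-1)}`. -/
def cConst (p : ℝ) : ℝ :=
  (1 - 1 / (2 * p)) * (2 / p) ^ (1 / (2 * p - 1))

/-- The decay rate
`min {2 (α₀ - α - (2p-1)/(2p) (2/p)^{1/(2p-1)} ‖β‖_p^{2p/(2p-1)}), 1}`. -/
def decayRate (p α₀ α : ℝ) (β : ℝ → ℝ) : ℝ :=
  min (2 * (α₀ - α - (2 * p - 1) / (2 * p) * (2 / p) ^ (1 / (2 * p - 1))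
    * normLp p β ^ (2 * p / (2 * p - 1)))) 1

/-- Exponential stability of the delayed problem: there are constants `M, δ > 0`, the same for all
data, with `‖u(t)‖ ≤ M e^{-δ t} max_{[-τ,0]} ‖u₀‖` for all `t ≥ 0` and all solutions. The maximum
is expressed by an arbitrary upper bound `K` of `‖u₀‖` on `[-τ, 0]`. -/
def IsExponentiallyStable (τ : ℝ) (l₀ l : ℝ → ℝ) : Prop :=
  ∃ M > 0, ∃ δ > 0, ∀ u₀ u : ℝ → L2, ContinuousOn u₀ (Icc (-τ) 0) → IsSolution τ l₀ l u₀ u →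
    ∀ K : ℝ, (∀ s ∈ Icc (-τ) 0, ‖u₀ s‖ ≤ K) →
      ∀ t : ℝ, 0 ≤ t → ‖u t‖ ≤ M * Real.exp (-δ * t) * K

end

end DelayedKdVBurgers

open DelayedKdVBurgers

namespace DelayedKdVBurgers

/-! Multiplying the equation by `u` gives, formally, `½ d/dt ‖u‖² = -‖u_x‖² - ∫ l₀ u² - ∫ l u(t-τ)
u`: the dispersive term contributes nothing and the Burgers term dissipates `‖u_x‖²`. Young's
inequality with weights `e^τ/2` and `e^{-τ}/2` splits the delayed term. The derivative of the memory
term of the Lyapunov functional cancels the delayed part exactly, adds `½ ∫ |l| u²`, and leaves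
minus the memory term itself. What must be controlled is `∫ ((e^τ+1)/2 |l| - α) u² ≤ ∫ |β| u²`.

That control is `integral_abs_mul_sq_le`: Hölder, Agmon's inequality and weighted AM-GM bound `∫ |β|
v²` by `‖v'‖² + κ ‖v‖²`, with coefficient exactly one on `‖v'‖²`, so that the dissipation absorbs
it. The smallness of `‖β‖_p` says precisely that `κ < α₀ - α` (`decayRate_pos`). Hence `E' ≤ -(α₀ -
α - κ) ‖u‖² - ½ (memory) ≤ -γ E`.

Solutions are only continuous in `L²`, so `u_x` need not make sense. The computation is done for `ρ
* u`, with `ρ` a smooth mollifier, and the dissipation is used up before the limit is taken. The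
resulting inequality contains no derivative, and every term is continuous on `L²`, so it passes to
the limit in integrated form (`IsWeakSolution.energy_le`). A Grönwall argument for continuous
functions (`le_mul_exp_of_sub_le_integral`) then gives the decay. -/

section

open Filter Topology
open scoped Convolution ENNReal RealInnerProductSpace

/-! ### Convolution operators on `L²`. -/

/-- Cauchy–Schwarz for a weighted lower Lebesgue integral. -/
theorem sq_lintegral_mul_le {X : Type*} [MeasurableSpace X] {μ : Measure X} {w F : X → ℝ≥0∞}
    (hw : Measurable w) (hF : Measurable F) :
    (∫⁻ x, w x * F x ∂μ) ^ 2 ≤ (∫⁻ x, w x ∂μ) * ∫⁻ x, w x * F x ^ 2 ∂μ := by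
  have hs : ∀ a : ℝ≥0∞, a ^ (1 / 2 : ℝ) * a ^ (1 / 2 : ℝ) = a := fun a => by
    rw [← ENNReal.rpow_add_of_nonneg _ _ (by norm_num) (by norm_num)]; norm_num
  have hs2 : ∀ a : ℝ≥0∞, (a ^ (1 / 2 : ℝ)) ^ (2 : ℝ) = a := fun a => by
    rw [← ENNReal.rpow_mul]; norm_num
  -- Split `w F = w^½ · (w^½ F)`.
  have h := ENNReal.lintegral_mul_le_Lp_mul_Lq μ Real.HolderConjugate.two_two
    (f := fun x => w x ^ (1 / 2 : ℝ)) (g := fun x => w x ^ (1 / 2 : ℝ) * F x)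
    (by fun_prop) (by fun_prop)
  have h1 : ∀ x, w x ^ (1 / 2 : ℝ) * (w x ^ (1 / 2 : ℝ) * F x) = w x * F x := fun x => by
    rw [← mul_assoc, hs]
  have h2 : ∀ x, (w x ^ (1 / 2 : ℝ) * F x) ^ (2 : ℝ) = w x * F x ^ 2 := fun x => by
    rw [ENNReal.mul_rpow_of_nonneg _ _ (by norm_num), hs2, ENNReal.rpow_two]
  simp only [Pi.mul_apply, h1, h2, hs2] at h
  calc (∫⁻ x, w x * F x ∂μ) ^ 2
      ≤ ((∫⁻ x, w x ∂μ) ^ (1 / 2 : ℝ) * (∫⁻ x, w x * F x ^ 2 ∂μ) ^ (1 / 2 : ℝ)) ^ 2 := by gcongr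
    _ = _ := by rw [mul_pow, ← ENNReal.rpow_two, ← ENNReal.rpow_two, hs2, hs2]

theorem eLpNorm_two_sq {X E : Type*} [MeasurableSpace X] [NormedAddCommGroup E] {μ : Measure X}
    (f : X → E) : eLpNorm f 2 μ ^ 2 = ∫⁻ x, ‖f x‖ₑ ^ 2 ∂μ := by
  have h : eLpNorm f 2 μ = eLpNorm f ((2 : NNReal) : ℝ≥0∞) μ := by norm_num
  have := eLpNorm_nnreal_pow_eq_lintegral (f := f) (μ := μ) (p := 2) (by norm_num)
  rw [h]
  simpa using this

/-- If `g` is pointwise dominated by a weighted average of the slices of `F`, its `L²` norm is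
controlled by the weighted average of the `L²` norms of the slices. -/
theorem eLpNorm_two_sq_le_of_enorm_le {g w : ℝ → ℝ} {F : ℝ → ℝ → ℝ} (hw : Measurable w)
    (hF : Measurable (Function.uncurry F)) (h : ∀ x, ‖g x‖ₑ ≤ ∫⁻ y, ‖w y‖ₑ * ‖F x y‖ₑ) :
    eLpNorm g 2 volume ^ 2
      ≤ (∫⁻ y, ‖w y‖ₑ) * ∫⁻ y, ‖w y‖ₑ * eLpNorm (fun x => F x y) 2 volume ^ 2 := by
  have hm : Measurable (Function.uncurry fun x y => ‖w y‖ₑ * ‖F x y‖ₑ ^ 2) :=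
    ((hw.comp measurable_snd).enorm).mul (hF.enorm.pow_const 2)
  calc eLpNorm g 2 volume ^ 2 = ∫⁻ x, ‖g x‖ₑ ^ 2 := eLpNorm_two_sq g
    _ ≤ ∫⁻ x, (∫⁻ y, ‖w y‖ₑ) * ∫⁻ y, ‖w y‖ₑ * ‖F x y‖ₑ ^ 2 := by
        refine lintegral_mono fun x => ?_
        refine (pow_le_pow_left' (h x) 2).trans ?_
        exact sq_lintegral_mul_le hw.enorm (hF.comp measurable_prodMk_left).enorm
    _ = (∫⁻ y, ‖w y‖ₑ) * ∫⁻ x, ∫⁻ y, ‖w y‖ₑ * ‖F x y‖ₑ ^ 2 := by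
        exact lintegral_const_mul _ hm.lintegral_prod_right'
    _ = (∫⁻ y, ‖w y‖ₑ) * ∫⁻ y, ∫⁻ x, ‖w y‖ₑ * ‖F x y‖ₑ ^ 2 := by
        rw [lintegral_lintegral_swap hm.aemeasurable]
    _ = _ := by
        congr 1
        refine lintegral_congr fun y => ?_
        rw [eLpNorm_two_sq, lintegral_const_mul]
        exact ((hF.comp measurable_prodMk_right).enorm).pow_const 2

theorem locallyIntegrable_coeFn (u : L2) : LocallyIntegrable u volume :=
  (Lp.memLp u).locallyIntegrable (by norm_num)

/-- The convolution of `ρ` with an `L²` function, in coordinates. -/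
theorem convolution_eq (ρ : ℝ → ℝ) (u : ℝ → ℝ) (x : ℝ) :
    (ρ ⋆[ContinuousLinearMap.mul ℝ ℝ] u) x = ∫ y, ρ y * u (x - y) := rfl

theorem convolution_eq_swap' (ρ : ℝ → ℝ) (u : ℝ → ℝ) (x : ℝ) :
    (ρ ⋆[ContinuousLinearMap.mul ℝ ℝ] u) x = ∫ y, u y * ρ (x - y) := by
  rw [convolution_eq_swap]
  simp [mul_comm]

theorem eLpNorm_translate (u : L2) (y : ℝ) :
    eLpNorm (fun x => u (x - y)) 2 volume = eLpNorm u 2 volume :=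
  eLpNorm_comp_measurePreserving (Lp.aestronglyMeasurable u)
    (measurePreserving_sub_right volume y)

/-- Young's inequality `L¹ * L² ⊂ L²`: the convolution averages translates of `u` with weight `ρ`,
and all translates have the same norm. -/
theorem eLpNorm_convolution_le {ρ : ℝ → ℝ} (hc : Continuous ρ) (u : L2) :
    eLpNorm (ρ ⋆[ContinuousLinearMap.mul ℝ ℝ] u) 2 volume
      ≤ (∫⁻ y, ‖ρ y‖ₑ) * eLpNorm u 2 volume := by
  have hu : Measurable u := (Lp.stronglyMeasurable u).measurable
  have h := eLpNorm_two_sq_le_of_enorm_le (g := ρ ⋆[ContinuousLinearMap.mul ℝ ℝ] u) (w := ρ)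
    (F := fun x y => u (x - y)) hc.measurable (hu.comp (measurable_fst.sub measurable_snd))
    (fun x => by
      rw [convolution_eq]
      refine (enorm_integral_le_lintegral_enorm _).trans_eq ?_
      simp [enorm_mul])
  simp only [eLpNorm_translate] at h
  rw [lintegral_mul_const _ hc.measurable.enorm, ← mul_assoc, ← sq, ← mul_pow] at h
  exact (ENNReal.pow_le_pow_left_iff two_ne_zero).1 h

theorem lintegral_enorm_lt_top {ρ : ℝ → ℝ} (hc : Continuous ρ) (hs : HasCompactSupport ρ) :
    ∫⁻ y, ‖ρ y‖ₑ < ⊤ := (hc.integrable_of_hasCompactSupport hs).2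

theorem memLp_convolution {ρ : ℝ → ℝ} (hc : Continuous ρ) (hs : HasCompactSupport ρ) (u : L2) :
    MemLp (ρ ⋆[ContinuousLinearMap.mul ℝ ℝ] u) 2 volume :=
  ⟨(hs.continuous_convolution_left _ hc (locallyIntegrable_coeFn u)).aestronglyMeasurable,
    (eLpNorm_convolution_le hc u).trans_lt
      (ENNReal.mul_lt_top (lintegral_enorm_lt_top hc hs) (Lp.eLpNorm_lt_top u))⟩

theorem convolutionExists {ρ : ℝ → ℝ} (hc : Continuous ρ) (hs : HasCompactSupport ρ) (u : L2) :
    ConvolutionExists ρ u (ContinuousLinearMap.mul ℝ ℝ) :=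
  hs.convolutionExists_left _ hc (locallyIntegrable_coeFn u)

theorem convolution_congr_ae (ρ : ℝ → ℝ) {u v : ℝ → ℝ} (h : u =ᵐ[volume] v) (x : ℝ) :
    (ρ ⋆[ContinuousLinearMap.mul ℝ ℝ] u) x = (ρ ⋆[ContinuousLinearMap.mul ℝ ℝ] v) x := by
  rw [convolution_eq_swap', convolution_eq_swap']
  refine integral_congr_ae ?_
  filter_upwards [h] with y hy
  rw [hy]

theorem norm_toLp_convolution_le {ρ : ℝ → ℝ} (hc : Continuous ρ) (hs : HasCompactSupport ρ)
    (u : L2) : ‖(memLp_convolution hc hs u).toLp _‖ ≤ (∫⁻ y, ‖ρ y‖ₑ).toReal * ‖u‖ := by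
  rw [Lp.norm_toLp, Lp.norm_def, ← ENNReal.toReal_mul]
  exact ENNReal.toReal_mono (ENNReal.mul_lt_top (lintegral_enorm_lt_top hc hs)
    (Lp.eLpNorm_lt_top u)).ne (eLpNorm_convolution_le hc u)

/-- Convolution with a continuous compactly supported kernel, as an operator on `L²`. -/
noncomputable def mollify (ρ : ℝ → ℝ) (hc : Continuous ρ) (hs : HasCompactSupport ρ) :
    L2 →L[ℝ] L2 :=
  LinearMap.mkContinuous
    { toFun := fun u => (memLp_convolution hc hs u).toLp _
      map_add' := fun u v => by
        rw [← MemLp.toLp_add]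
        refine MemLp.toLp_congr _ _ (Eventually.of_forall fun x => ?_)
        rw [convolution_congr_ae ρ (Lp.coeFn_add u v),
          ConvolutionExistsAt.distrib_add (convolutionExists hc hs u x)
            (convolutionExists hc hs v x)]
        rfl
      map_smul' := fun c u => by
        rw [RingHom.id_apply, ← MemLp.toLp_const_smul]
        refine MemLp.toLp_congr _ _ (Eventually.of_forall fun x => ?_)
        rw [convolution_congr_ae ρ (Lp.coeFn_smul c u), convolution_smul] }
    (∫⁻ y, ‖ρ y‖ₑ).toReal
    (fun u => by
      exact norm_toLp_convolution_le hc hs u)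

theorem coeFn_mollify {ρ : ℝ → ℝ} (hc : Continuous ρ) (hs : HasCompactSupport ρ) (u : L2) :
    mollify ρ hc hs u =ᵐ[volume] ρ ⋆[ContinuousLinearMap.mul ℝ ℝ] u :=
  MemLp.coeFn_toLp (memLp_convolution hc hs u)

theorem norm_mollify_le {ρ : ℝ → ℝ} (hc : Continuous ρ) (hs : HasCompactSupport ρ)
    (h0 : ∀ x, 0 ≤ ρ x) (h1 : ∫ x, ρ x = 1) (u : L2) : ‖mollify ρ hc hs u‖ ≤ ‖u‖ := by
  have h : (∫⁻ y, ‖ρ y‖ₑ).toReal = 1 := by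
    rw [← h1, integral_eq_lintegral_of_nonneg_ae (Eventually.of_forall h0)
      hc.aestronglyMeasurable]
    simp only [Real.enorm_of_nonneg (h0 _)]
  have := norm_toLp_convolution_le hc hs u
  rwa [h, one_mul] at this

/-! ### Approximate identities. -/

/-- Translations act continuously on `L²`. -/
theorem tendsto_eLpNorm_translate_sub (u : L2) :
    Tendsto (fun y : ℝ => eLpNorm (fun x => u (x - y) - u x) 2 volume) (𝓝 0) (𝓝 0) := by
  let g : ℝ → C(ℝ, ℝ) := fun y => ⟨fun x => x - y, by fun_prop⟩
  have hgm : ∀ y, MeasurePreserving (g y) volume volume := fun y =>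
    measurePreserving_sub_right volume y
  have hg : Continuous g := ContinuousMap.continuous_of_continuous_uncurry _ (by
    show Continuous fun q : ℝ × ℝ => q.2 - q.1
    fun_prop)
  have hcont : Continuous fun y => Lp.compMeasurePreserving (g y) (hgm y) u :=
    continuous_const.compMeasurePreservingLp hg hgm (by norm_num)
  have h0 := (hcont.tendsto 0)
  rw [Lp.tendsto_Lp_iff_tendsto_eLpNorm'] at h0
  refine h0.congr fun y => eLpNorm_congr_ae ?_
  filter_upwards [Lp.coeFn_compMeasurePreserving u (hgm y),
    Lp.coeFn_compMeasurePreserving u (hgm 0)] with x h1 h2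
  rw [Pi.sub_apply, h1, h2]
  simp [g]

/-- Approximate identities converge strongly to the identity on `L²`. -/
theorem tendsto_mollify {ρ : ℕ → ℝ → ℝ} (hc : ∀ n, Continuous (ρ n))
    (hs : ∀ n, HasCompactSupport (ρ n)) (h0 : ∀ n x, 0 ≤ ρ n x) (h1 : ∀ n, ∫ x, ρ n x = 1)
    {r : ℕ → ℝ} (hr : Tendsto r atTop (𝓝 0)) (hsupp : ∀ n x, r n ≤ |x| → ρ n x = 0) (u : L2) :
    Tendsto (fun n => mollify (ρ n) (hc n) (hs n) u) atTop (𝓝 u) := by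
  have hu : Measurable u := (Lp.stronglyMeasurable u).measurable
  have hone : ∀ n, ∫⁻ y, ‖ρ n y‖ₑ = 1 := fun n => by
    have := ofReal_integral_eq_lintegral_ofReal
      ((hc n).integrable_of_hasCompactSupport (hs n) (μ := volume)) (Eventually.of_forall (h0 n))
    rw [h1 n, ENNReal.ofReal_one] at this
    rw [this]
    simp only [Real.enorm_of_nonneg (h0 n _)]
  rw [Lp.tendsto_Lp_iff_tendsto_eLpNorm', ENNReal.tendsto_nhds_zero]
  intro ε hε
  obtain ⟨δ, hδ, hball⟩ := Metric.eventually_nhds_iff.1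
    ((ENNReal.tendsto_nhds_zero.1 (tendsto_eLpNorm_translate_sub u)) ε hε)
  filter_upwards [hr.eventually (gt_mem_nhds hδ)] with n hn
  have hae : (⇑(mollify (ρ n) (hc n) (hs n) u) - ⇑u)
      =ᵐ[volume] fun x => (ρ n ⋆[ContinuousLinearMap.mul ℝ ℝ] u) x - u x := by
    filter_upwards [coeFn_mollify (hc n) (hs n) u] with x hx
    simp [hx]
  rw [eLpNorm_congr_ae hae]
  -- Unit mass of the kernel turns the error into an average of translation errors.
  have hdiff : ∀ x, (ρ n ⋆[ContinuousLinearMap.mul ℝ ℝ] u) x - u x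
      = ∫ y, ρ n y * (u (x - y) - u x) := fun x => by
    have e1 : Integrable (fun y => ρ n y * u (x - y)) :=
      (convolutionExists (hc n) (hs n) u x).integrable
    have e2 : Integrable (fun y => ρ n y * u x) :=
      ((hc n).integrable_of_hasCompactSupport (hs n)).mul_const _
    simp only [mul_sub]
    rw [integral_sub e1 e2, integral_mul_const, h1 n, one_mul, convolution_eq]
  have h := eLpNorm_two_sq_le_of_enorm_le
    (g := fun x => (ρ n ⋆[ContinuousLinearMap.mul ℝ ℝ] u) x - u x) (w := ρ n)
    (F := fun x y => u (x - y) - u x) (hc n).measurable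
    ((hu.comp (measurable_fst.sub measurable_snd)).sub (hu.comp measurable_fst))
    (fun x => by
      rw [hdiff]
      refine (enorm_integral_le_lintegral_enorm _).trans_eq ?_
      simp [enorm_mul])
  rw [hone n, one_mul] at h
  have h2 : ∫⁻ y, ‖ρ n y‖ₑ * eLpNorm (fun x => u (x - y) - u x) 2 volume ^ 2
      ≤ ∫⁻ y, ‖ρ n y‖ₑ * ε ^ 2 := by
    refine lintegral_mono fun y => ?_
    -- Either the kernel vanishes, or `|y| < r n < δ` and the translation error is at most `ε`.
    by_cases hy : r n ≤ |y|
    · simp [hsupp n y hy]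
    · have := hball (y := y) (by rw [Real.dist_eq, sub_zero]; linarith)
      gcongr
  rw [lintegral_mul_const _ (hc n).measurable.enorm, hone n, one_mul] at h2
  exact (ENNReal.pow_le_pow_left_iff two_ne_zero).1 (h.trans h2)

/-- There is a smooth nonnegative approximate identity with shrinking compact supports. -/
theorem exists_mollifier : ∃ ρ : ℕ → ℝ → ℝ, (∀ n, ContDiff ℝ ∞ (ρ n)) ∧
    (∀ n, HasCompactSupport (ρ n)) ∧ (∀ n x, 0 ≤ ρ n x) ∧ (∀ n, ∫ x, ρ n x = 1) ∧
    ∃ r : ℕ → ℝ, Tendsto r atTop (𝓝 0) ∧ ∀ n x, r n ≤ |x| → ρ n x = 0 := by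
  let φ : ℕ → ContDiffBump (0 : ℝ) := fun n =>
    ⟨1 / (2 * ((n : ℝ) + 1)), 1 / ((n : ℝ) + 1), by positivity, by
      rw [one_div_lt_one_div (by positivity) (by positivity)]; linarith [n.cast_nonneg (α := ℝ)]⟩
  refine ⟨fun n => (φ n).normed volume, fun n => (φ n).contDiff_normed,
    fun n => (φ n).hasCompactSupport_normed, fun n => (φ n).nonneg_normed,
    fun n => (φ n).integral_normed, fun n => 1 / ((n : ℝ) + 1),
    tendsto_one_div_add_atTop_nhds_zero_nat, fun n x hx => ?_⟩
  by_contra hne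
  have : x ∈ Function.support ((φ n).normed volume) := hne
  rw [(φ n).support_normed_eq, Metric.mem_ball, Real.dist_eq, sub_zero] at this
  exact absurd hx (not_le.2 this)

/-! ### Absorbing an `L^p` potential into the dissipation. -/

theorem integral_abs_mul_le_sqrt {f g : ℝ → ℝ} (hf : MemLp f 2 volume) (hg : MemLp g 2 volume) :
    ∫ x, |f x * g x| ≤ √(∫ x, f x ^ 2) * √(∫ x, g x ^ 2) := by
  have h := integral_mul_norm_le_Lp_mul_Lq (μ := volume) (f := f) (g := g)
    Real.HolderConjugate.two_two (by simpa using hf) (by simpa using hg)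
  simpa [abs_mul, Real.sqrt_eq_rpow] using h

/-- Agmon's inequality on the line. -/
theorem sq_le_two_mul_sqrt_mul_sqrt {v v' : ℝ → ℝ} (hv : ∀ x, HasDerivAt v (v' x) x)
    (h : MemLp v 2 volume) (h' : MemLp v' 2 volume) (x : ℝ) :
    v x ^ 2 ≤ 2 * (√(∫ y, v y ^ 2) * √(∫ y, v' y ^ 2)) := by
  have hi : Integrable fun y => v y * v' y := h.integrable_mul h'
  have hd : ∀ y, HasDerivAt (fun y => v y ^ 2) (2 * (v y * v' y)) y := fun y => by
    convert! (hv y).pow 2 using 1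
    ring
  -- An integrable function with integrable derivative vanishes at `-∞`, so `v(x)² = 2 ∫_{-∞}^x v
  -- v'`. Integrating from one side only is the origin of the factor 2.
  have h0 : Tendsto (fun y => v y ^ 2) atBot (𝓝 0) :=
    tendsto_zero_of_hasDerivAt_of_integrableOn_Iic (a := x) (fun y _ => hd y)
      (hi.const_mul 2).integrableOn h.integrable_sq.integrableOn
  have h1 := integral_Iic_of_hasDerivAt_of_tendsto' (fun y _ => hd y)
    (hi.const_mul 2).integrableOn h0 (a := x)
  rw [sub_zero, integral_const_mul] at h1
  rw [← h1]
  refine mul_le_mul_of_nonneg_left ?_ zero_le_two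
  refine le_trans ?_ (integral_abs_mul_le_sqrt h h')
  calc ∫ y in Iic x, v y * v' y ≤ ∫ y in Iic x, |v y * v' y| :=
        integral_mono hi.integrableOn hi.abs.integrableOn fun y => le_abs_self _
    _ ≤ ∫ y, |v y * v' y| :=
        setIntegral_le_integral hi.abs (Eventually.of_forall fun y => abs_nonneg _)

theorem normLp_nonneg (p : ℝ) (β : ℝ → ℝ) : 0 ≤ normLp p β := ENNReal.toReal_nonneg

theorem normLp_eq {p : ℝ} (hp : 1 ≤ p) {β : ℝ → ℝ} (hβ : MemLp β (ENNReal.ofReal p) volume) :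
    normLp p β = (∫ x, |β x| ^ p) ^ (1 / p) := by
  have hp0 : 0 < p := by linarith
  rw [normLp, hβ.eLpNorm_eq_integral_rpow_norm (by simpa using hp0) ENNReal.ofReal_ne_top,
    ENNReal.toReal_ofReal (by positivity)]
  simp [ENNReal.toReal_ofReal hp0.le]

/-- Hölder's inequality with the second factor interpolated between `L¹` and `L^∞`. -/
theorem integral_abs_mul_le_normLp {p : ℝ} (hp : 1 ≤ p) {β w : ℝ → ℝ}
    (hβ : MemLp β (ENNReal.ofReal p) volume) (hw0 : ∀ x, 0 ≤ w x) (hw : Integrable w) {N : ℝ}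
    (hN : ∀ x, w x ≤ N) :
    Integrable (fun x => |β x| * w x) ∧
      ∫ x, |β x| * w x ≤ normLp p β * (N ^ (1 / p) * (∫ x, w x) ^ (1 - 1 / p)) := by
  have hN0 : 0 ≤ N := (hw0 0).trans (hN 0)
  -- For `p = 1` the conjugate exponent is infinite, and the bound `w ≤ N` replaces Hölder.
  rcases hp.eq_or_lt with rfl | hp1
  · have hβ1 : Integrable β := memLp_one_iff_integrable.1 (by simpa using hβ)
    have hi : Integrable (fun x => |β x| * w x) :=
      hβ1.abs.mul_bdd (c := N) hw.aestronglyMeasurable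
        (Eventually.of_forall fun x => by rw [Real.norm_of_nonneg (hw0 x)]; exact hN x)
    refine ⟨hi, ?_⟩
    rw [normLp_eq le_rfl hβ]
    simp only [Real.rpow_one, div_one, sub_self, Real.rpow_zero, mul_one]
    rw [← integral_mul_const]
    exact integral_mono hi (hβ1.abs.mul_const N)
      fun x => mul_le_mul_of_nonneg_left (hN x) (abs_nonneg _)
  · set q := p.conjExponent with hq
    have hpq : p.HolderConjugate q := Real.HolderConjugate.conjExponent hp1
    have hq0 : 0 < q := hpq.symm.pos
    have hp0 : 0 < p := hpq.pos
    have hq1 : 1 < q := hpq.symm.lt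
    have hinv : 1 / q = 1 - 1 / p := by
      have := hpq.inv_add_inv_eq_one
      simp only [one_div]; linarith
    -- Interpolation: `w^q ≤ N^{q-1} w`, and `(q-1)/q = 1/p` gives the exponent of `N` in the claim.
    have hpw : ∀ x, w x ^ q ≤ N ^ (q - 1) * w x := fun x => by
      rcases (hw0 x).eq_or_lt with h | h
      · rw [← h, Real.zero_rpow hq0.ne', mul_zero]
      · have : w x ^ q = w x ^ (q - 1) * w x := by
          rw [← Real.rpow_add_one h.ne']; ring_nf
        rw [this]
        exact mul_le_mul_of_nonneg_right
          (Real.rpow_le_rpow (hw0 x) (hN x) (by linarith)) (hw0 x)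
    have hwq : MemLp w (ENNReal.ofReal q) volume := by
      rw [← integrable_norm_rpow_iff hw.aestronglyMeasurable (by simpa using hq0)
        ENNReal.ofReal_ne_top, ENNReal.toReal_ofReal hq0.le]
      refine (hw.const_mul (N ^ (q - 1))).mono'
        ((hw.aestronglyMeasurable.norm.aemeasurable.pow_const q).aestronglyMeasurable)
        (Eventually.of_forall fun x => ?_)
      rw [Real.norm_of_nonneg (hw0 x), Real.norm_of_nonneg (Real.rpow_nonneg (hw0 x) _)]
      exact hpw x
    have : ENNReal.HolderConjugate (ENNReal.ofReal p) (ENNReal.ofReal q) := by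
      exact hpq.ennrealOfReal
    refine ⟨hβ.abs.integrable_mul hwq, ?_⟩
    have h := integral_mul_le_Lp_mul_Lq_of_nonneg (μ := volume) hpq (f := fun x => |β x|) (g := w)
      (Eventually.of_forall fun x => abs_nonneg _) (Eventually.of_forall hw0) hβ.abs hwq
    rw [← normLp_eq hp hβ] at h
    refine h.trans (mul_le_mul_of_nonneg_left ?_ (normLp_nonneg p β))
    have hint : ∫ x, w x ^ q ≤ N ^ (q - 1) * ∫ x, w x := by
      rw [← integral_const_mul]
      refine integral_mono_of_nonneg (Eventually.of_forall fun x => Real.rpow_nonneg (hw0 x) _)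
        (hw.const_mul _) (Eventually.of_forall hpw)
    have hI0 : 0 ≤ ∫ x, w x := integral_nonneg hw0
    calc (∫ x, w x ^ q) ^ (1 / q) ≤ (N ^ (q - 1) * ∫ x, w x) ^ (1 / q) :=
          Real.rpow_le_rpow (integral_nonneg fun x => Real.rpow_nonneg (hw0 x) _) hint
            (by positivity)
      _ = N ^ (1 / p) * (∫ x, w x) ^ (1 - 1 / p) := by
          rw [Real.mul_rpow (Real.rpow_nonneg hN0 _) hI0, ← Real.rpow_mul hN0, ← hinv]
          congr 2
          have : (q - 1) * (1 / q) = 1 - 1 / q := by field_simp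
          rw [this, hinv]; ring

/-- The optimised form of Young's inequality that produces the constant of the decay rate. -/
theorem mul_rpow_le_add {p : ℝ} (hp : 1 ≤ p) {A D B : ℝ} (hA : 0 ≤ A) (hD : 0 ≤ D) (hB : 0 ≤ B) :
    B * ((2 * (√A * √D)) ^ (1 / p) * A ^ (1 - 1 / p))
      ≤ D + (2 * p - 1) / (2 * p) * (2 / p) ^ (1 / (2 * p - 1)) * B ^ (2 * p / (2 * p - 1)) * A := by
  have hp0 : 0 < p := by linarith
  have hq0 : 0 < 2 * p - 1 := by linarith
  have hr0 : 0 ≤ (2 / p) ^ (1 / (2 * p - 1)) := by positivity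
  have hB0 : 0 ≤ B ^ (2 * p / (2 * p - 1)) := Real.rpow_nonneg hB _
  set θ := 1 / (2 * p) with hθ
  have hθ0 : 0 ≤ θ := by positivity
  have hθ1 : 1 - θ = (2 * p - 1) / (2 * p) := by rw [hθ]; field_simp
  have h1p : 0 ≤ 1 - 1 / p := by
    rw [sub_nonneg, div_le_one hp0]; exact hp
  -- The weight is `θ = 1/(2p)` because `D` enters the left side to the power `1/(2p)`. The first
  -- entry `2pD` is chosen so that `θ · 2pD = D` has coefficient one. The factor `(2/p)^{1/(2p-1)}`
  -- in the second entry then restores the constant, since `(2p)^θ (2/p)^θ = 4^θ = 2^{1/p}`.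
  have h := Real.geom_mean_le_arith_mean2_weighted (w₁ := θ) (w₂ := 1 - θ) (p₁ := 2 * p * D)
    (p₂ := (2 / p) ^ (1 / (2 * p - 1)) * B ^ (2 * p / (2 * p - 1)) * A) hθ0
    (by rw [hθ1]; positivity) (by positivity) (by positivity) (by ring)
  have e2 : θ * (2 * p * D) + (1 - θ) *
      ((2 / p) ^ (1 / (2 * p - 1)) * B ^ (2 * p / (2 * p - 1)) * A)
      = D + (2 * p - 1) / (2 * p) * (2 / p) ^ (1 / (2 * p - 1)) *
        B ^ (2 * p / (2 * p - 1)) * A := by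
    rw [hθ1, hθ]; field_simp
  have e3 : ((2 / p) ^ (1 / (2 * p - 1))) ^ (1 - θ) = (2 / p) ^ θ := by
    rw [← Real.rpow_mul (by positivity), hθ1, hθ]; congr 1; field_simp
  have e4 : (B ^ (2 * p / (2 * p - 1))) ^ (1 - θ) = B := by
    rw [← Real.rpow_mul hB, hθ1]
    have : 2 * p / (2 * p - 1) * ((2 * p - 1) / (2 * p)) = 1 := by field_simp
    rw [this, Real.rpow_one]
  have e5 : (2 : ℝ) ^ (1 / p) = (2 * p) ^ θ * (2 / p) ^ θ := by
    rw [← Real.mul_rpow (by positivity) (by positivity)]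
    have : 2 * p * (2 / p) = (2 : ℝ) ^ (2 : ℝ) := by
      rw [Real.rpow_two]; field_simp
    rw [this, ← Real.rpow_mul (by norm_num), hθ]; congr 1; field_simp
  have e6 : ∀ a : ℝ, 0 ≤ a → √a ^ (1 / p) = a ^ θ := fun a ha => by
    rw [Real.sqrt_eq_rpow, ← Real.rpow_mul ha, hθ]; congr 1; field_simp
  have e7 : A ^ θ * A ^ (1 - 1 / p) = A ^ (1 - θ) := by
    rw [← Real.rpow_add_of_nonneg hA hθ0 h1p, hθ]; congr 1; field_simp; ring
  rw [e2] at h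
  refine le_trans (le_of_eq ?_) h
  rw [Real.mul_rpow (by positivity) hD, Real.mul_rpow (by positivity) hA,
    Real.mul_rpow hr0 hB0, e3, e4, Real.mul_rpow zero_le_two (by positivity),
    Real.mul_rpow (Real.sqrt_nonneg _) (Real.sqrt_nonneg _), e6 A hA, e6 D hD, e5, ← e7]
  ring

/-- The Gagliardo–Nirenberg type inequality absorbing an `L^p` potential into the dissipation. -/
theorem integral_abs_mul_sq_le {p : ℝ} (hp : 1 ≤ p) {β v v' : ℝ → ℝ}
    (hβ : MemLp β (ENNReal.ofReal p) volume) (hv : ∀ x, HasDerivAt v (v' x) x)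
    (h : MemLp v 2 volume) (h' : MemLp v' 2 volume) :
    Integrable (fun x => |β x| * v x ^ 2) ∧ ∫ x, |β x| * v x ^ 2
      ≤ (∫ x, v' x ^ 2) + (2 * p - 1) / (2 * p) * (2 / p) ^ (1 / (2 * p - 1)) *
        normLp p β ^ (2 * p / (2 * p - 1)) * ∫ x, v x ^ 2 := by
  have h1 := integral_abs_mul_le_normLp hp hβ (fun x => sq_nonneg (v x)) h.integrable_sq
    (sq_le_two_mul_sqrt_mul_sqrt hv h h')
  exact ⟨h1.1, h1.2.trans (mul_rpow_le_add hp (integral_nonneg fun x => sq_nonneg _)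
    (integral_nonneg fun x => sq_nonneg _) (normLp_nonneg p β))⟩

/-- The exponent `2p/(2p-1)` is the reciprocal of `1 - 1/(2p)`, so raising the smallness hypothesis
to that power turns it into `c_p ‖β‖_p^{2p/(2p-1)} < α₀ - α`. -/
theorem decayRate_pos {p : ℝ} (hp : 1 ≤ p) {α₀ α : ℝ} {β : ℝ → ℝ} (hαα₀ : α < α₀)
    (hβα : normLp p β < ((α₀ - α) / cConst p) ^ (1 - 1 / (2 * p))) :
    0 < α₀ - α - (2 * p - 1) / (2 * p) * (2 / p) ^ (1 / (2 * p - 1)) *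
      normLp p β ^ (2 * p / (2 * p - 1)) := by
  have hp0 : 0 < p := by linarith
  have hq0 : 0 < 2 * p - 1 := by linarith
  have hc : cConst p = (2 * p - 1) / (2 * p) * (2 / p) ^ (1 / (2 * p - 1)) := by
    rw [cConst]; congr 1; field_simp
  have hc0 : 0 < cConst p := by rw [hc]; positivity
  have hθ1 : 1 - 1 / (2 * p) = (2 * p - 1) / (2 * p) := by field_simp
  have h := Real.rpow_lt_rpow (normLp_nonneg p β) hβα
    (show 0 < 2 * p / (2 * p - 1) by positivity)
  have hd : 0 ≤ (α₀ - α) / cConst p := div_nonneg (by linarith) hc0.le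
  have he : (1 - 1 / (2 * p)) * (2 * p / (2 * p - 1)) = 1 := by rw [hθ1]; field_simp
  rw [← Real.rpow_mul hd, he, Real.rpow_one, lt_div_iff₀ hc0, mul_comm] at h
  rw [← hc]
  linarith

/-! ### Multiplication operators and quadratic forms. -/

/-- Multiplication by an essentially bounded function, as an operator on `L²`. -/
noncomputable def mulOp (m : ℝ → ℝ) (hm : MemLp m ⊤ volume) : L2 →L[ℝ] L2 :=
  (ContinuousLinearMap.mul ℝ ℝ).holderL volume ⊤ 2 2 (hm.toLp m)

theorem coeFn_mulOp {m : ℝ → ℝ} (hm : MemLp m ⊤ volume) (u : L2) :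
    mulOp m hm u =ᵐ[volume] fun x => m x * u x := by
  have h : mulOp m hm u
      =ᵐ[volume] fun x => (ContinuousLinearMap.mul ℝ ℝ) (hm.toLp m x) (u x) :=
    (ContinuousLinearMap.mul ℝ ℝ).coeFn_holder (r := 2) (hm.toLp m) u
  filter_upwards [h, hm.coeFn_toLp] with x h1 h2
  rw [h1, h2]; rfl

theorem inner_eq_integral (u w : L2) : ⟪u, w⟫ = ∫ x, u x * w x := by
  rw [L2.inner_def]
  refine integral_congr_ae (Eventually.of_forall fun x => ?_)
  simp [mul_comm]

theorem norm_sq_eq_integral (u : L2) : ‖u‖ ^ 2 = ∫ x, u x ^ 2 := by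
  rw [← real_inner_self_eq_norm_sq, inner_eq_integral]
  simp only [sq]

theorem inner_mulOp {m : ℝ → ℝ} (hm : MemLp m ⊤ volume) (u w : L2) :
    ⟪mulOp m hm u, w⟫ = ∫ x, m x * u x * w x := by
  rw [inner_eq_integral]
  refine integral_congr_ae ?_
  filter_upwards [coeFn_mulOp hm u] with x hx
  rw [hx]

/-! ### Mollification by derivatives of a test function. -/

section Smooth

variable {ρ : ℝ → ℝ}

theorem continuous_iteratedDeriv_of_smooth (hρ : ContDiff ℝ ∞ ρ) (k : ℕ) :
    Continuous (iteratedDeriv k ρ) :=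
  hρ.continuous_iteratedDeriv k (by exact_mod_cast le_top)

theorem contDiff_iteratedDeriv_of_smooth (hρ : ContDiff ℝ ∞ ρ) (k : ℕ) :
    ContDiff ℝ ∞ (iteratedDeriv k ρ) := by
  rw [iteratedDeriv_eq_iterate]
  exact hρ.iterate_deriv k

theorem hasCompactSupport_iteratedDeriv (hs : HasCompactSupport ρ) (k : ℕ) :
    HasCompactSupport (iteratedDeriv k ρ) := by
  induction k with
  | zero => simpa using hs
  | succ k ih => rw [iteratedDeriv_succ]; exact ih.deriv

theorem iteratedDeriv_const_sub (hρ : ContDiff ℝ ∞ ρ) (x : ℝ) (k : ℕ) :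
    iteratedDeriv k (fun y => ρ (x - y)) = fun y => (-1) ^ k * iteratedDeriv k ρ (x - y) := by
  induction k with
  | zero => simp
  | succ k ih =>
    rw [iteratedDeriv_succ, ih]
    ext y
    have h : HasDerivAt (iteratedDeriv k ρ) (deriv (iteratedDeriv k ρ) (x - y)) (x - y) :=
      ((contDiff_iteratedDeriv_of_smooth hρ k).differentiable (by simp) _).hasDerivAt
    have h2 := ((HasDerivAt.comp_const_sub x y h).const_mul ((-1 : ℝ) ^ k)).deriv
    rw [h2, iteratedDeriv_succ]
    ring

/-- Convolution with the `k`-th derivative of a test function, as an operator on `L²`. -/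
noncomputable def mollifyDeriv (hρ : ContDiff ℝ ∞ ρ) (hs : HasCompactSupport ρ) (k : ℕ) :
    L2 →L[ℝ] L2 :=
  mollify (iteratedDeriv k ρ) (continuous_iteratedDeriv_of_smooth hρ k)
    (hasCompactSupport_iteratedDeriv hs k)

theorem coeFn_mollifyDeriv (hρ : ContDiff ℝ ∞ ρ) (hs : HasCompactSupport ρ) (k : ℕ) (u : L2) :
    mollifyDeriv hρ hs k u =ᵐ[volume] iteratedDeriv k ρ ⋆[ContinuousLinearMap.mul ℝ ℝ] u :=
  coeFn_mollify _ _ u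

theorem mollifyDeriv_zero (hρ : ContDiff ℝ ∞ ρ) (hs : HasCompactSupport ρ) :
    mollifyDeriv hρ hs 0 = mollify ρ hρ.continuous hs := by
  simp only [mollifyDeriv, iteratedDeriv_zero]

theorem hasDerivAt_convolution_iteratedDeriv (hρ : ContDiff ℝ ∞ ρ) (hs : HasCompactSupport ρ)
    (k : ℕ) (u : L2) (x : ℝ) :
    HasDerivAt (iteratedDeriv k ρ ⋆[ContinuousLinearMap.mul ℝ ℝ] u)
      ((iteratedDeriv (k + 1) ρ ⋆[ContinuousLinearMap.mul ℝ ℝ] u) x) x := by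
  rw [iteratedDeriv_succ]
  exact (hasCompactSupport_iteratedDeriv hs k).hasDerivAt_convolution_left _
    ((contDiff_iteratedDeriv_of_smooth hρ k).of_le (by exact_mod_cast le_top))
    (locallyIntegrable_coeFn u) x

theorem memLp_convolution_iteratedDeriv (hρ : ContDiff ℝ ∞ ρ) (hs : HasCompactSupport ρ)
    (k : ℕ) (u : L2) :
    MemLp (iteratedDeriv k ρ ⋆[ContinuousLinearMap.mul ℝ ℝ] u) 2 volume :=
  memLp_convolution (continuous_iteratedDeriv_of_smooth hρ k)
    (hasCompactSupport_iteratedDeriv hs k) u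

/-- Integration by parts for mollified functions. -/
theorem inner_mollifyDeriv_succ (hρ : ContDiff ℝ ∞ ρ) (hs : HasCompactSupport ρ) (j k : ℕ)
    (u : L2) : ⟪mollifyDeriv hρ hs j u, mollifyDeriv hρ hs (k + 1) u⟫
      = -⟪mollifyDeriv hρ hs (j + 1) u, mollifyDeriv hρ hs k u⟫ := by
  have e : ∀ i l, ⟪mollifyDeriv hρ hs i u, mollifyDeriv hρ hs l u⟫
      = ∫ x, (iteratedDeriv i ρ ⋆[ContinuousLinearMap.mul ℝ ℝ] u) x *
        (iteratedDeriv l ρ ⋆[ContinuousLinearMap.mul ℝ ℝ] u) x := fun i l => by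
    rw [inner_eq_integral]
    refine integral_congr_ae ?_
    filter_upwards [coeFn_mollifyDeriv hρ hs i u, coeFn_mollifyDeriv hρ hs l u] with x h1 h2
    rw [h1, h2]
  rw [e, e]
  have m := memLp_convolution_iteratedDeriv hρ hs (u := u)
  exact integral_mul_deriv_eq_deriv_mul_of_integrable
    (fun x _ => hasDerivAt_convolution_iteratedDeriv hρ hs j u x)
    (fun x _ => hasDerivAt_convolution_iteratedDeriv hρ hs k u x)
    ((m j).integrable_mul (m (k + 1))) ((m (j + 1)).integrable_mul (m k))
    ((m j).integrable_mul (m k))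

/-- The linear part of the equation dissipates exactly the `L²` norm of the first derivative. -/
theorem inner_mollify_dispersion (hρ : ContDiff ℝ ∞ ρ) (hs : HasCompactSupport ρ) (u : L2) :
    ⟪mollifyDeriv hρ hs 0 u, -mollifyDeriv hρ hs 3 u + mollifyDeriv hρ hs 2 u⟫
      = -‖mollifyDeriv hρ hs 1 u‖ ^ 2 := by
  -- With `D_k` for the `k`-th derivative of the mollified function: `⟪D₀, D₃⟫ = -⟪D₁, D₂⟫`, and
  -- this vanishes since `⟪D₁, D₂⟫ = -⟪D₂, D₁⟫`. Also `⟪D₀, D₂⟫ = -‖D₁‖²`.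
  have h1 := inner_mollifyDeriv_succ hρ hs 0 2 u
  have h2 := inner_mollifyDeriv_succ hρ hs 1 1 u
  have h3 := inner_mollifyDeriv_succ hρ hs 0 1 u
  have h4 := real_inner_comm (mollifyDeriv hρ hs 1 u) (mollifyDeriv hρ hs 2 u)
  rw [inner_add_right, inner_neg_right]
  norm_num at h1 h2 h3
  linarith

/-- Pointwise values of a mollified function depend continuously and linearly on the function. -/
theorem exists_clm_eq_convolution {ρ : ℝ → ℝ} (hc : Continuous ρ) (hs : HasCompactSupport ρ)
    (x : ℝ) :
    ∃ L : L2 →L[ℝ] ℝ, ∀ u : L2, L u = (ρ ⋆[ContinuousLinearMap.mul ℝ ℝ] u) x := by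
  have hm : MemLp (fun y => ρ (x - y)) 2 volume :=
    (hc.comp (continuous_const.sub continuous_id)).memLp_of_hasCompactSupport
      (hs.comp_homeomorph (Homeomorph.subLeft x))
  refine ⟨innerSL ℝ (hm.toLp _), fun u => ?_⟩
  rw [innerSL_apply_apply, inner_eq_integral, convolution_eq_swap']
  refine integral_congr_ae ?_
  filter_upwards [hm.coeFn_toLp] with y hy
  rw [hy, mul_comm]

theorem continuous_convolution_apply {ρ : ℝ → ℝ} (hc : Continuous ρ) (hs : HasCompactSupport ρ)
    {u : ℝ → L2} (hu : Continuous u) (x : ℝ) :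
    Continuous fun r => (ρ ⋆[ContinuousLinearMap.mul ℝ ℝ] u r) x := by
  obtain ⟨L, hL⟩ := exists_clm_eq_convolution hc hs x
  simp only [← hL]
  exact L.continuous.comp hu

theorem intervalIntegral_convolution_apply {ρ : ℝ → ℝ} (hc : Continuous ρ)
    (hs : HasCompactSupport ρ) {u : ℝ → L2} (hu : Continuous u) (x s t : ℝ) :
    ∫ r in s..t, (ρ ⋆[ContinuousLinearMap.mul ℝ ℝ] u r) x
      = (ρ ⋆[ContinuousLinearMap.mul ℝ ℝ] (∫ r in s..t, u r : L2)) x := by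
  obtain ⟨L, hL⟩ := exists_clm_eq_convolution hc hs x
  simp only [← hL]
  exact L.intervalIntegral_comp_comm (hu.intervalIntegrable s t)

end Smooth

/-! ### Energy inequality for weak solutions with a source. -/

/-- `u_t + u_xxx - u_xx = f` on `(0, ∞)` in the sense of distributions in the space variable. -/
def IsWeakSolution (u f : ℝ → L2) : Prop :=
  ∀ φ : ℝ → ℝ, ContDiff ℝ ∞ φ → HasCompactSupport φ → ∀ t : ℝ, 0 < t →
    HasDerivAt (fun r : ℝ => ∫ x, u r x * φ x)
      ((∫ x, u t x * iteratedDeriv 3 φ x) + (∫ x, u t x * iteratedDeriv 2 φ x)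
        + ∫ x, f t x * φ x) t

section Energy

variable {u f : ℝ → L2} {ρ : ℝ → ℝ}

/-- Test the equation with `y ↦ ρ (x - y)`. The reflection changes the sign of odd derivatives,
hence the minus in front of the third-order term. -/
theorem IsWeakSolution.hasDerivAt_convolution (h : IsWeakSolution u f) (hρ : ContDiff ℝ ∞ ρ)
    (hs : HasCompactSupport ρ) (x : ℝ) {t : ℝ} (ht : 0 < t) :
    HasDerivAt (fun r => (ρ ⋆[ContinuousLinearMap.mul ℝ ℝ] u r) x)
      (-(iteratedDeriv 3 ρ ⋆[ContinuousLinearMap.mul ℝ ℝ] u t) x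
        + (iteratedDeriv 2 ρ ⋆[ContinuousLinearMap.mul ℝ ℝ] u t) x
        + (ρ ⋆[ContinuousLinearMap.mul ℝ ℝ] f t) x) t := by
  have h1 := h (fun y => ρ (x - y)) (hρ.comp (contDiff_const.sub contDiff_id))
    (hs.comp_homeomorph (Homeomorph.subLeft x)) t ht
  rw [iteratedDeriv_const_sub hρ, iteratedDeriv_const_sub hρ] at h1
  simp only [convolution_eq_swap']
  convert! h1 using 3
  · rw [← integral_neg]; congr 1; ext y; ring
  · congr 1; ext y; ring

/-- Passes from differentiability in time at each fixed `x` to an identity between Bochner integrals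
in `L²`. This integral form is what yields the derivative in the `L²` norm in `hasDerivAt_mollify`.
-/
theorem IsWeakSolution.mollify_sub (h : IsWeakSolution u f) (hu : Continuous u)
    (hf : Continuous f) (hρ : ContDiff ℝ ∞ ρ) (hs : HasCompactSupport ρ) {s t : ℝ} (hs0 : 0 < s)
    (ht0 : 0 < t) :
    mollifyDeriv hρ hs 0 (u t) - mollifyDeriv hρ hs 0 (u s)
      = ∫ r in s..t, (-mollifyDeriv hρ hs 3 (u r) + mollifyDeriv hρ hs 2 (u r)
        + mollifyDeriv hρ hs 0 (f r)) := by
  have c := continuous_iteratedDeriv_of_smooth hρ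
  have k := hasCompactSupport_iteratedDeriv hs
  have i3 : IntervalIntegrable (fun r => -mollifyDeriv hρ hs 3 (u r)) volume s t :=
    ((mollifyDeriv hρ hs 3).continuous.comp hu).neg.intervalIntegrable s t
  have i2 : IntervalIntegrable (fun r => mollifyDeriv hρ hs 2 (u r)) volume s t :=
    ((mollifyDeriv hρ hs 2).continuous.comp hu).intervalIntegrable s t
  have i0 : IntervalIntegrable (fun r => mollifyDeriv hρ hs 0 (f r)) volume s t :=
    ((mollifyDeriv hρ hs 0).continuous.comp hf).intervalIntegrable s t
  -- Moving the operators outside the integrals leaves finitely many elements of `L²` whose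
  -- representatives have to be compared, so the exceptional null set does not depend on `r`.
  rw [intervalIntegral.integral_add (i3.add i2) i0, intervalIntegral.integral_add i3 i2,
    intervalIntegral.integral_neg,
    ContinuousLinearMap.intervalIntegral_comp_comm _ (hu.intervalIntegrable s t),
    ContinuousLinearMap.intervalIntegral_comp_comm _ (hu.intervalIntegrable s t),
    ContinuousLinearMap.intervalIntegral_comp_comm _ (hf.intervalIntegrable s t)]
  set U := ∫ r in s..t, u r
  set F := ∫ r in s..t, f r
  apply Lp.ext
  filter_upwards [Lp.coeFn_sub (mollifyDeriv hρ hs 0 (u t)) (mollifyDeriv hρ hs 0 (u s)),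
    Lp.coeFn_add (-mollifyDeriv hρ hs 3 U + mollifyDeriv hρ hs 2 U) (mollifyDeriv hρ hs 0 F),
    Lp.coeFn_add (-mollifyDeriv hρ hs 3 U) (mollifyDeriv hρ hs 2 U),
    Lp.coeFn_neg (mollifyDeriv hρ hs 3 U), coeFn_mollifyDeriv hρ hs 0 (u t),
    coeFn_mollifyDeriv hρ hs 0 (u s), coeFn_mollifyDeriv hρ hs 3 U,
    coeFn_mollifyDeriv hρ hs 2 U, coeFn_mollifyDeriv hρ hs 0 F] with x e1 e2 e3 e4 e5 e6 e7 e8 e9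
  simp only [e1, e2, e3, e4, e5, e6, e7, e8, e9, Pi.sub_apply, Pi.add_apply, Pi.neg_apply]
  have c3 : Continuous fun r =>
      -(iteratedDeriv 3 ρ ⋆[ContinuousLinearMap.mul ℝ ℝ] u r) x :=
    (continuous_convolution_apply (c 3) (k 3) hu x).neg
  have c2 := continuous_convolution_apply (c 2) (k 2) hu x
  have c0 := continuous_convolution_apply (c 0) (k 0) hf x
  have hftc := intervalIntegral.integral_eq_sub_of_hasDerivAt (a := s) (b := t)
    (fun r hr => h.hasDerivAt_convolution hρ hs x
      ((lt_min hs0 ht0).trans_le hr.1))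
    (by
      rw [iteratedDeriv_zero] at c0
      exact ((c3.add c2).add c0).intervalIntegrable s t)
  simp only [iteratedDeriv_zero] at c0 ⊢
  rw [← hftc, intervalIntegral.integral_add
      ((c3.intervalIntegrable s t).add (c2.intervalIntegrable s t)) (c0.intervalIntegrable s t),
    intervalIntegral.integral_add (c3.intervalIntegrable s t) (c2.intervalIntegrable s t),
    intervalIntegral.integral_neg, intervalIntegral_convolution_apply (c 3) (k 3) hu,
    intervalIntegral_convolution_apply (c 2) (k 2) hu,
    intervalIntegral_convolution_apply hρ.continuous hs hf]

theorem IsWeakSolution.hasDerivAt_mollify (h : IsWeakSolution u f) (hu : Continuous u)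
    (hf : Continuous f) (hρ : ContDiff ℝ ∞ ρ) (hs : HasCompactSupport ρ) {t : ℝ} (ht : 0 < t) :
    HasDerivAt (fun r => mollifyDeriv hρ hs 0 (u r))
      (-mollifyDeriv hρ hs 3 (u t) + mollifyDeriv hρ hs 2 (u t)
        + mollifyDeriv hρ hs 0 (f t)) t := by
  have hW : Continuous fun r => -mollifyDeriv hρ hs 3 (u r) + mollifyDeriv hρ hs 2 (u r)
        + mollifyDeriv hρ hs 0 (f r) := by fun_prop
  have h1 := (hW.integral_hasStrictDerivAt t t).hasDerivAt.const_add (mollifyDeriv hρ hs 0 (u t))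
  refine h1.congr_of_eventuallyEq ?_
  filter_upwards [lt_mem_nhds ht] with r hr
  rw [← h.mollify_sub hu hf hρ hs ht hr]
  abel

/-- Energy inequality for the mollified solution. -/
theorem IsWeakSolution.mollified_energy_le (h : IsWeakSolution u f) (hu : Continuous u)
    (hf : Continuous f) (hρ : ContDiff ℝ ∞ ρ) (hs : HasCompactSupport ρ) {b : ℝ → ℝ}
    (hb : MemLp b ⊤ volume) {κ : ℝ}
    (hκ : ∀ v v' : ℝ → ℝ, (∀ x, HasDerivAt v (v' x) x) → MemLp v 2 volume → MemLp v' 2 volume →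
      ∫ x, b x * v x ^ 2 ≤ (∫ x, v' x ^ 2) + κ * ∫ x, v x ^ 2)
    {s t : ℝ} (hs0 : 0 < s) (hst : s ≤ t) :
    1 / 2 * ‖mollifyDeriv hρ hs 0 (u t)‖ ^ 2 - 1 / 2 * ‖mollifyDeriv hρ hs 0 (u s)‖ ^ 2
      ≤ ∫ r in s..t, (κ * ‖mollifyDeriv hρ hs 0 (u r)‖ ^ 2
        - ⟪mulOp b hb (mollifyDeriv hρ hs 0 (u r)), mollifyDeriv hρ hs 0 (u r)⟫
        + ⟪mollifyDeriv hρ hs 0 (u r), mollifyDeriv hρ hs 0 (f r)⟫) := by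
  have hftc := intervalIntegral.integral_eq_sub_of_hasDerivAt (a := s) (b := t)
    (f := fun r => 1 / 2 * ‖mollifyDeriv hρ hs 0 (u r)‖ ^ 2)
    (f' := fun r => ⟪mollifyDeriv hρ hs 0 (u r), -mollifyDeriv hρ hs 3 (u r)
        + mollifyDeriv hρ hs 2 (u r) + mollifyDeriv hρ hs 0 (f r)⟫)
    (fun r hr => by
      have hr0 : 0 < r := hs0.trans_le ((uIcc_of_le hst ▸ hr).1)
      convert! (h.hasDerivAt_mollify hu hf hρ hs hr0).norm_sq.const_mul (1 / 2) using 1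
      ring)
    (by apply Continuous.intervalIntegrable; fun_prop)
  rw [← hftc]
  refine intervalIntegral.integral_mono_on hst
    (by apply Continuous.intervalIntegrable; fun_prop)
    (by apply Continuous.intervalIntegrable; fun_prop) fun r _ => ?_
  rw [inner_add_right, inner_mollify_dispersion]
  have h0 := coeFn_mollifyDeriv hρ hs 0 (u r)
  have h1 := coeFn_mollifyDeriv hρ hs 1 (u r)
  -- The dissipation `‖D₁‖²` is traded here for the form of `b`, so no derivative of `u` survives in
  -- the bound.
  have hk := hκ _ _ (fun x => hasDerivAt_convolution_iteratedDeriv hρ hs 0 (u r) x)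
    (memLp_convolution_iteratedDeriv hρ hs 0 (u r))
    (memLp_convolution_iteratedDeriv hρ hs 1 (u r))
  have e0 : ‖mollifyDeriv hρ hs 0 (u r)‖ ^ 2
      = ∫ x, (iteratedDeriv 0 ρ ⋆[ContinuousLinearMap.mul ℝ ℝ] u r) x ^ 2 := by
    rw [norm_sq_eq_integral]
    exact integral_congr_ae (by filter_upwards [h0] with x hx; rw [hx])
  have e1 : ‖mollifyDeriv hρ hs 1 (u r)‖ ^ 2
      = ∫ x, (iteratedDeriv 1 ρ ⋆[ContinuousLinearMap.mul ℝ ℝ] u r) x ^ 2 := by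
    rw [norm_sq_eq_integral]
    exact integral_congr_ae (by filter_upwards [h1] with x hx; rw [hx])
  have e2 : ⟪mulOp b hb (mollifyDeriv hρ hs 0 (u r)), mollifyDeriv hρ hs 0 (u r)⟫
      = ∫ x, b x * (iteratedDeriv 0 ρ ⋆[ContinuousLinearMap.mul ℝ ℝ] u r) x ^ 2 := by
    rw [inner_mulOp]
    exact integral_congr_ae (by filter_upwards [h0] with x hx; rw [hx]; ring)
  rw [e2, e1, e0]
  linarith

/-- Energy inequality for weak solutions: the dissipation absorbs the potential `b`. -/
theorem IsWeakSolution.energy_le (h : IsWeakSolution u f) (hu : Continuous u)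
    (hf : Continuous f) {b : ℝ → ℝ} (hb : MemLp b ⊤ volume) {κ : ℝ}
    (hκ : ∀ v v' : ℝ → ℝ, (∀ x, HasDerivAt v (v' x) x) → MemLp v 2 volume → MemLp v' 2 volume →
      ∫ x, b x * v x ^ 2 ≤ (∫ x, v' x ^ 2) + κ * ∫ x, v x ^ 2)
    {s t : ℝ} (hs0 : 0 < s) (hst : s ≤ t) :
    1 / 2 * ‖u t‖ ^ 2 - 1 / 2 * ‖u s‖ ^ 2
      ≤ ∫ r in s..t, (κ * ‖u r‖ ^ 2 - ⟪mulOp b hb (u r), u r⟫ + ⟪u r, f r⟫) := by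
  obtain ⟨ρ, hρ, hsupp, h0, h1, r, hr, hrs⟩ := exists_mollifier
  have hlim : ∀ w : L2, Tendsto (fun n => mollifyDeriv (hρ n) (hsupp n) 0 w) atTop (𝓝 w) :=
    fun w => by
      simp only [mollifyDeriv_zero]
      exact tendsto_mollify _ _ h0 h1 hr hrs w
  have hle : ∀ n w, ‖mollifyDeriv (hρ n) (hsupp n) 0 w‖ ≤ ‖w‖ := fun n w => by
    rw [mollifyDeriv_zero]
    exact norm_mollify_le _ _ (h0 n) (h1 n) w
  -- All terms are continuous on `L²`; since mollification is a contraction, a majorant independent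
  -- of `n` is available for dominated convergence in time.
  refine le_of_tendsto_of_tendsto'
    ((((hlim (u t)).norm.pow 2).const_mul (1 / 2)).sub (((hlim (u s)).norm.pow 2).const_mul (1 / 2)))
    ?_ fun n => h.mollified_energy_le hu hf (hρ n) (hsupp n) hb hκ hs0 hst
  refine intervalIntegral.tendsto_integral_filter_of_dominated_convergence
    (fun r => |κ| * ‖u r‖ ^ 2 + ‖mulOp b hb‖ * ‖u r‖ * ‖u r‖ + ‖u r‖ * ‖f r‖)
    (Eventually.of_forall fun n => ?_) (Eventually.of_forall fun n =>
      Eventually.of_forall fun r _ => ?_)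
    (by apply Continuous.intervalIntegrable; fun_prop)
    (Eventually.of_forall fun r _ => ?_)
  · exact Continuous.aestronglyMeasurable (by fun_prop)
  · set V := mollifyDeriv (hρ n) (hsupp n) 0 (u r)
    have hV : ‖V‖ ≤ ‖u r‖ := hle n (u r)
    have hF := hle n (f r)
    refine (norm_add_le _ _).trans (add_le_add ((norm_sub_le _ _).trans (add_le_add ?_ ?_)) ?_)
    · rw [Real.norm_eq_abs, abs_mul, abs_of_nonneg (sq_nonneg ‖V‖)]
      gcongr
    · refine (norm_inner_le_norm _ _).trans ?_
      have := (mulOp b hb).le_opNorm V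
      gcongr
      exact this.trans (by gcongr)
    · refine (norm_inner_le_norm _ _).trans ?_
      gcongr
  · have hU := hlim (u r)
    exact (((hU.norm.pow 2).const_mul κ).sub
      ((((mulOp b hb).continuous.tendsto _).comp hU).inner hU)).add (hU.inner (hlim (f r)))

end Energy

/-! ### Grönwall's inequality and the memory term. -/

/-- An integral form of Grönwall's inequality allowing decay. -/
theorem le_mul_exp_of_sub_le_integral {E h : ℝ → ℝ} (hE : Continuous E) (hh : Continuous h)
    {γ : ℝ} (hle : ∀ s t, 0 < s → s ≤ t → E t - E s ≤ ∫ r in s..t, h r)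
    (hγ : ∀ r, 0 < r → h r ≤ -γ * E r) {t : ℝ} (ht : 0 ≤ t) :
    E t ≤ E 0 * Real.exp (-γ * t) := by
  have key : ∀ s, 0 < s → s ≤ t → E t ≤ E s * Real.exp (-γ * (t - s)) := fun s hs hst => by
    have hg := le_gronwallBound_of_liminf_deriv_right_le (f := E) (f' := h) (δ := E s) (K := -γ)
      (ε := 0) (a := s) (b := t) hE.continuousOn ?_ le_rfl
      (fun x hx => by simpa using hγ x (hs.trans_le hx.1)) t (right_mem_Icc.2 hst)
    · rwa [gronwallBound_ε0] at hg
    -- `E` need not be differentiable: its right slopes at `x` are bounded by those of `∫ h`, which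
    -- tend to `h x`, and Grönwall asks for no more.
    · intro x hx r hr
      have hd : HasDerivAt (fun z => ∫ y in x..z, h y) (h x) x :=
        (hh.integral_hasStrictDerivAt x x).hasDerivAt
      have hslope := (hasDerivAt_iff_tendsto_slope.1 hd).mono_left
        (nhdsWithin_mono x (fun z (hz : x < z) => ne_of_gt hz) : 𝓝[>] x ≤ 𝓝[≠] x)
      refine Eventually.frequently ?_
      filter_upwards [hslope.eventually (gt_mem_nhds hr), self_mem_nhdsWithin] with z hz hxz
      have hxz' : x < z := hxz
      refine lt_of_le_of_lt ?_ hz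
      rw [slope_def_field, intervalIntegral.integral_same, sub_zero, div_eq_inv_mul]
      exact mul_le_mul_of_nonneg_left (hle x z (hs.trans_le hx.1) hxz'.le)
        (inv_nonneg.2 (sub_nonneg.2 hxz'.le))
  rcases ht.eq_or_lt with rfl | ht0
  · simp
  -- The inequality is only available from positive times on; continuity of `E` lets `s` tend to `0`
  -- from the right.
  · have hc : Continuous fun s => E s * Real.exp (-γ * (t - s)) := by fun_prop
    have hlim := (hc.tendsto 0).mono_left (nhdsWithin_le_nhds (s := Ioi 0))
    simp only [sub_zero] at hlim
    refine ge_of_tendsto hlim ?_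
    filter_upwards [Ioc_mem_nhdsGT ht0] with s hs
    exact key s hs.1 hs.2

/-- The memory part of the Lyapunov functional for a scalar density `G`. -/
noncomputable def memory (τ : ℝ) (G : ℝ → ℝ) (t : ℝ) : ℝ :=
  ∫ s in (t - τ)..t, Real.exp (-(t - s)) * G s

/-- Factoring `e^{-t}` out of the integral leaves only the endpoints depending on `t`. The summand
`-memory` comes from differentiating this factor and makes the memory term decay at rate one, whence
the cap `1` in the decay rate. -/
theorem hasDerivAt_memory (τ : ℝ) {G : ℝ → ℝ} (hG : Continuous G) (t : ℝ) :
    HasDerivAt (memory τ G) (G t - Real.exp (-τ) * G (t - τ) - memory τ G t) t := by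
  have hc : Continuous fun s => Real.exp s * G s := by fun_prop
  have hQ : ∀ x, HasDerivAt (fun z => ∫ s in (0 : ℝ)..z, Real.exp s * G s)
      (Real.exp x * G x) x := fun x => (hc.integral_hasStrictDerivAt 0 x).hasDerivAt
  have hM : memory τ G = fun t => Real.exp (-t) * ((∫ s in (0 : ℝ)..t, Real.exp s * G s)
      - ∫ s in (0 : ℝ)..(t - τ), Real.exp s * G s) := by
    ext t
    rw [intervalIntegral.integral_interval_sub_left (hc.intervalIntegrable _ _)
      (hc.intervalIntegrable _ _), ← intervalIntegral.integral_const_mul]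
    refine intervalIntegral.integral_congr fun s _ => ?_
    rw [← mul_assoc, ← Real.exp_add]
    congr 2
    ring
  have hd := ((hasDerivAt_neg t).exp).mul ((hQ t).sub ((hQ (t - τ)).comp_sub_const t τ))
  have h1 : Real.exp (-t) * Real.exp t = 1 := by rw [← Real.exp_add]; simp
  have h2 : Real.exp (-t) * Real.exp (t - τ) = Real.exp (-τ) := by rw [← Real.exp_add]; ring_nf
  rw [hM]
  convert! hd using 1
  simp only [Pi.sub_apply]
  linear_combination (-G t) * h1 + G (t - τ) * h2

theorem memory_nonneg {τ : ℝ} (hτ : 0 ≤ τ) {G : ℝ → ℝ} (hG : ∀ s, 0 ≤ G s) (t : ℝ) :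
    0 ≤ memory τ G t :=
  intervalIntegral.integral_nonneg (by linarith) fun s _ =>
    mul_nonneg (Real.exp_pos _).le (hG s)

theorem integrable_mul_mul {m : ℝ → ℝ} (hm : MemLp m ⊤ volume) (u w : L2) :
    Integrable fun x => m x * u x * w x :=
  (((Lp.memLp (mulOp m hm u)).ae_eq (coeFn_mulOp hm u))).integrable_mul (Lp.memLp w)

theorem norm_sq_le_inner_mulOp {m : ℝ → ℝ} (hm : MemLp m ⊤ volume) {a : ℝ}
    (ha : ∀ᵐ x : ℝ, a ≤ m x) (u : L2) : a * ‖u‖ ^ 2 ≤ ⟪mulOp m hm u, u⟫ := by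
  rw [inner_mulOp, norm_sq_eq_integral, ← integral_const_mul]
  refine integral_mono_ae ((Lp.memLp u).integrable_sq.const_mul a) (integrable_mul_mul hm u u) ?_
  filter_upwards [ha] with x hx
  have := mul_le_mul_of_nonneg_right hx (sq_nonneg (u x))
  linarith

theorem inner_mulOp_abs_nonneg {m : ℝ → ℝ} (hm : MemLp (fun x => |m x|) ⊤ volume) (u : L2) :
    0 ≤ ⟪mulOp _ hm u, u⟫ := by
  simpa using norm_sq_le_inner_mulOp hm (Eventually.of_forall fun x => abs_nonneg (m x)) u

/-- Weighted Young inequality for the delayed term. -/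
theorem neg_inner_mulOp_le {m : ℝ → ℝ} (hm : MemLp m ⊤ volume)
    (hma : MemLp (fun x => |m x|) ⊤ volume) (τ : ℝ) (u w : L2) :
    -⟪mulOp m hm w, u⟫ ≤ Real.exp τ / 2 * ⟪mulOp _ hma u, u⟫
      + Real.exp (-τ) / 2 * ⟪mulOp _ hma w, w⟫ := by
  have iu := (integrable_mul_mul hma u u).const_mul (Real.exp τ / 2)
  have iw := (integrable_mul_mul hma w w).const_mul (Real.exp (-τ) / 2)
  rw [inner_mulOp, inner_mulOp, inner_mulOp, ← integral_neg, ← integral_const_mul,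
    ← integral_const_mul, ← integral_add iu iw]
  refine integral_mono (integrable_mul_mul hm w u).neg (iu.add iw) fun x => ?_
  simp only
  have h1 : Real.exp τ * Real.exp (-τ) = 1 := by rw [← Real.exp_add]; simp
  -- This is `e^{-τ} (e^τ |u| - |w|)² ≥ 0`, expanded.
  have h2 : |w x| * |u x| ≤ Real.exp τ / 2 * u x ^ 2 + Real.exp (-τ) / 2 * w x ^ 2 := by
    have h3 := mul_nonneg (Real.exp_pos (-τ)).le (sq_nonneg (Real.exp τ * |u x| - |w x|))
    have h4 : Real.exp (-τ) * (Real.exp τ * |u x| - |w x|) ^ 2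
        = Real.exp τ * u x ^ 2 - 2 * (|w x| * |u x|) + Real.exp (-τ) * w x ^ 2 := by
      rw [← sq_abs (u x), ← sq_abs (w x)]
      linear_combination (Real.exp τ * |u x| ^ 2 - 2 * |w x| * |u x|) * h1
    linarith
  have h5 := mul_le_mul_of_nonneg_left h2 (abs_nonneg (m x))
  have h6 : -(m x * w x * u x) ≤ |m x| * (|w x| * |u x|) := by
    rw [← abs_mul, ← abs_mul, ← mul_assoc]; exact neg_le_abs _
  linarith

theorem inner_mulOp_sub_const {m : ℝ → ℝ} (hm : MemLp m ⊤ volume) {c a : ℝ}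
    (hb : MemLp (fun x => c * m x - a) ⊤ volume) (u : L2) :
    ⟪mulOp _ hb u, u⟫ = c * ⟪mulOp m hm u, u⟫ - a * ‖u‖ ^ 2 := by
  rw [inner_mulOp, inner_mulOp, norm_sq_eq_integral, ← integral_const_mul, ← integral_const_mul,
    ← integral_sub ((integrable_mul_mul hm u u).const_mul c)
      ((Lp.memLp u).integrable_sq.const_mul a)]
  congr 1; ext x; ring

theorem integral_weight_mul_sq {m : ℝ → ℝ} (hm : MemLp m ⊤ volume) (c : ℝ) (u : L2) :
    ∫ x, c * m x * u x ^ 2 = c * ⟪mulOp m hm u, u⟫ := by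
  rw [inner_mulOp, ← integral_const_mul]
  congr 1; ext x; ring

/-! ### Lyapunov estimates for the delayed problem. -/

/-- The constant extension of a curve to the left of `-τ`. -/
noncomputable def extendLeft (τ : ℝ) (u : ℝ → L2) (t : ℝ) : L2 := u (max (-τ) t)

theorem extendLeft_eq {τ : ℝ} (u : ℝ → L2) {t : ℝ} (ht : -τ ≤ t) : extendLeft τ u t = u t := by
  rw [extendLeft, max_eq_right ht]

section Solution

variable {τ : ℝ} {l₀ l : ℝ → ℝ} {u₀ u : ℝ → L2}

theorem IsSolution.continuous_extendLeft (h : IsSolution τ l₀ l u₀ u) :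
    Continuous (extendLeft τ u) :=
  h.continuousOn.comp_continuous (by fun_prop) fun _ => mem_Ici.2 (le_max_left _ _)

/-- The reaction and delay terms become an `L²`-continuous source. For `t > 0` both `t` and `t - τ`
exceed `-τ`, so the extension does not affect the equation. -/
theorem IsSolution.isWeakSolution (h : IsSolution τ l₀ l u₀ u) (hτ : 0 < τ)
    (hl₀ : MemLp l₀ ⊤ volume) (hl : MemLp l ⊤ volume) :
    IsWeakSolution (extendLeft τ u) fun t =>
      -(mulOp l₀ hl₀ (extendLeft τ u t) + mulOp l hl (extendLeft τ u (t - τ))) := by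
  intro φ hφ hs t ht
  have h1 := h.equation φ hφ hs t ht
  have hφ2 : MemLp φ 2 volume := hφ.continuous.memLp_of_hasCompactSupport hs
  have e : ∫ x, (-(mulOp l₀ hl₀ (extendLeft τ u t)
        + mulOp l hl (extendLeft τ u (t - τ))) : L2) x * φ x
      = -(∫ x, l₀ x * u t x * φ x) - ∫ x, l x * u (t - τ) x * φ x := by
    rw [extendLeft_eq u (by linarith), extendLeft_eq u (by linarith)]
    have i1 : Integrable fun x => l₀ x * u t x * φ x :=
      ((Lp.memLp _).ae_eq (coeFn_mulOp hl₀ (u t))).integrable_mul hφ2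
    have i2 : Integrable fun x => l x * u (t - τ) x * φ x :=
      ((Lp.memLp _).ae_eq (coeFn_mulOp hl (u (t - τ)))).integrable_mul hφ2
    rw [neg_sub_left, ← integral_add i2 i1, ← integral_neg]
    refine integral_congr_ae ?_
    filter_upwards [Lp.coeFn_neg (mulOp l₀ hl₀ (u t) + mulOp l hl (u (t - τ))),
      Lp.coeFn_add (mulOp l₀ hl₀ (u t)) (mulOp l hl (u (t - τ))), coeFn_mulOp hl₀ (u t),
      coeFn_mulOp hl (u (t - τ))] with x h1 h2 h3 h4
    simp only [h1, h2, h3, h4, Pi.neg_apply, Pi.add_apply]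
    ring
  simp only [e]
  rw [extendLeft_eq u (by linarith)]
  refine HasDerivAt.congr_of_eventuallyEq (f := fun r : ℝ => ∫ x, u r x * φ x) ?_ ?_
  · convert! h1 using 1
    ring
  · filter_upwards [lt_mem_nhds ht] with r hr
    rw [extendLeft_eq u (by linarith)]

theorem lyapunov_eq (hla : MemLp (fun x => |l x|) ⊤ volume) (hτ : 0 < τ) {t : ℝ} (ht : 0 ≤ t) :
    lyapunov τ l u t = 1 / 2 * ‖extendLeft τ u t‖ ^ 2
      + 1 / 2 * memory τ (fun s => ⟪mulOp _ hla (extendLeft τ u s), extendLeft τ u s⟫) t := by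
  rw [lyapunov, memory, norm_sq_eq_integral, extendLeft_eq u (by linarith)]
  congr 2
  refine intervalIntegral.integral_congr fun s hs => ?_
  rw [uIcc_of_le (by linarith)] at hs
  rw [extendLeft_eq u (by linarith [hs.1]), ← integral_weight_mul_sq hla]

theorem IsSolution.initialConst_eq (h : IsSolution τ l₀ l u₀ u)
    (hla : MemLp (fun x => |l x|) ⊤ volume) (hτ : 0 < τ) :
    initialConst τ l u₀ = 1 / 2 * ‖extendLeft τ u 0‖ ^ 2
      + memory τ (fun s => ⟪mulOp _ hla (extendLeft τ u s), extendLeft τ u s⟫) 0 := by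
  rw [initialConst, memory, extendLeft_eq u (by linarith),
    h.initial 0 (right_mem_Icc.2 (by linarith)), zero_sub]
  congr 1
  refine intervalIntegral.integral_congr fun s hs => ?_
  rw [uIcc_of_le (by linarith)] at hs
  rw [extendLeft_eq u hs.1, h.initial s hs, ← integral_weight_mul_sq hla]
  simp

/-- Exponential decay of the Lyapunov functional under an abstract coercivity assumption on the
potential `(e^τ + 1) / 2 * |l| - α`. -/
theorem IsSolution.lyapunov_le (h : IsSolution τ l₀ l u₀ u) (hτ : 0 < τ)
    (hl₀ : MemLp l₀ ⊤ volume) (hl : MemLp l ⊤ volume) {α₀ α κ : ℝ}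
    (hl₀α₀ : ∀ᵐ x : ℝ, α₀ ≤ l₀ x)
    (hκ : ∀ v v' : ℝ → ℝ, (∀ x, HasDerivAt v (v' x) x) → MemLp v 2 volume → MemLp v' 2 volume →
      ∫ x, ((Real.exp τ + 1) / 2 * |l x| - α) * v x ^ 2
        ≤ (∫ x, v' x ^ 2) + κ * ∫ x, v x ^ 2) {t : ℝ} (ht : 0 ≤ t) :
    lyapunov τ l u t
      ≤ lyapunov τ l u 0 * Real.exp (-min (2 * (α₀ - α - κ)) 1 * t) := by
  have hla : MemLp (fun x => |l x|) ⊤ volume := hl.abs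
  have hb : MemLp (fun x => (Real.exp τ + 1) / 2 * |l x| - α) ⊤ volume :=
    (hla.const_mul _).sub (memLp_top_const α)
  rw [lyapunov_eq hla hτ ht, lyapunov_eq hla hτ le_rfl]
  have hU := h.continuous_extendLeft
  have hw := h.isWeakSolution hτ hl₀ hl
  set U := extendLeft τ u
  set f : ℝ → L2 := fun t => -(mulOp l₀ hl₀ (U t) + mulOp l hl (U (t - τ))) with hf
  set G : ℝ → ℝ := fun s => ⟪mulOp _ hla (U s), U s⟫ with hG
  have hfc : Continuous f := by fun_prop
  have hGc : Continuous G := by fun_prop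
  have hG0 : ∀ s, 0 ≤ G s := fun s => inner_mulOp_abs_nonneg hla (U s)
  have hFd := hasDerivAt_memory τ hGc
  have hFc : Continuous (memory τ G) :=
    continuous_iff_continuousAt.2 fun x => (hFd x).continuousAt
  have hF0 := memory_nonneg hτ.le hG0
  have c1 : Continuous fun r => κ * ‖U r‖ ^ 2 - ⟪mulOp _ hb (U r), U r⟫ + ⟪U r, f r⟫ := by
    fun_prop
  have c2 : Continuous fun r => G r - Real.exp (-τ) * G (r - τ) - memory τ G r := by fun_prop
  refine le_mul_exp_of_sub_le_integral
    (E := fun t => 1 / 2 * ‖U t‖ ^ 2 + 1 / 2 * memory τ G t)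
    (h := fun r => (κ * ‖U r‖ ^ 2 - ⟪mulOp _ hb (U r), U r⟫ + ⟪U r, f r⟫)
      + 1 / 2 * (G r - Real.exp (-τ) * G (r - τ) - memory τ G r))
    (by fun_prop) (by fun_prop) (fun s t hs hst => ?_) (fun r _ => ?_) ht
  · have h1 := hw.energy_le hU hfc hb hκ hs hst
    have h2 := intervalIntegral.integral_eq_sub_of_hasDerivAt (a := s) (b := t)
      (fun r _ => hFd r) (c2.intervalIntegrable s t)
    rw [intervalIntegral.integral_add (c1.intervalIntegrable s t)
      ((c2.intervalIntegrable s t).const_mul _), intervalIntegral.integral_const_mul, h2]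
    linarith
  · have e1 : ⟪U r, f r⟫ = -⟪mulOp l₀ hl₀ (U r), U r⟫ - ⟪mulOp l hl (U (r - τ)), U r⟫ := by
      rw [hf, inner_neg_right, inner_add_right, real_inner_comm (mulOp l₀ hl₀ (U r)),
        real_inner_comm (mulOp l hl (U (r - τ)))]
      ring
    have e2 := inner_mulOp_sub_const hla hb (U r)
    have e3 := norm_sq_le_inner_mulOp hl₀ hl₀α₀ (U r)
    -- The delayed contribution `e^{-τ}/2 · G (r - τ)` cancels against the memory derivative, while
    -- `e^τ/2 · G r + 1/2 · G r` cancels against the form of `b`. What remains is `-(α₀ - α - κ) ‖U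
    -- r‖²` minus half the memory term.
    have e4 := neg_inner_mulOp_le hl hla τ (U r) (U (r - τ))
    have g1 := min_le_left (2 * (α₀ - α - κ)) 1
    have g2 := min_le_right (2 * (α₀ - α - κ)) 1
    have g3 := mul_le_mul_of_nonneg_right g1 (sq_nonneg ‖U r‖)
    have g4 := mul_le_mul_of_nonneg_right g2 (hF0 r)
    rw [e1, e2]
    simp only [hG] at g4 ⊢
    linarith

/-- `initialConst` counts the nonnegative memory integral with factor one instead of one half. -/
theorem IsSolution.lyapunov_zero_le (h : IsSolution τ l₀ l u₀ u) (hτ : 0 < τ)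
    (hl : MemLp l ⊤ volume) : lyapunov τ l u 0 ≤ initialConst τ l u₀ := by
  have hla : MemLp (fun x => |l x|) ⊤ volume := hl.abs
  rw [lyapunov_eq hla hτ le_rfl, h.initialConst_eq hla hτ]
  linarith [memory_nonneg hτ.le (fun s => inner_mulOp_abs_nonneg hla (extendLeft τ u s)) 0]

theorem half_norm_sq_le_lyapunov (hl : MemLp l ⊤ volume) (hτ : 0 < τ) {t : ℝ} (ht : 0 ≤ t) :
    1 / 2 * ‖u t‖ ^ 2 ≤ lyapunov τ l u t := by
  have hla : MemLp (fun x => |l x|) ⊤ volume := hl.abs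
  rw [lyapunov_eq hla hτ ht, extendLeft_eq u (by linarith)]
  linarith [memory_nonneg hτ.le (fun s => inner_mulOp_abs_nonneg hla (extendLeft τ u s)) t]

/-- Bounds the energy constant by the data norm, using `e^s ≤ 1` on `[-τ, 0]` and the operator norm
of multiplication by `|l|`. It supplies the constant `M` of exponential stability. -/
theorem IsSolution.initialConst_le (h : IsSolution τ l₀ l u₀ u) (hτ : 0 < τ)
    (hla : MemLp (fun x => |l x|) ⊤ volume) {K : ℝ} (hK : ∀ s ∈ Icc (-τ) 0, ‖u₀ s‖ ≤ K) :
    initialConst τ l u₀ ≤ 1 / 2 * ((1 + 2 * τ * ‖mulOp _ hla‖) * K ^ 2) := by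
  have hU := h.continuous_extendLeft
  have hle : ∀ s ∈ Icc (-τ) 0, ‖extendLeft τ u s‖ ≤ K := fun s hs => by
    rw [extendLeft_eq u hs.1, h.initial s hs]; exact hK s hs
  have h0 := pow_le_pow_left₀ (norm_nonneg _) (hle 0 (right_mem_Icc.2 (by linarith))) 2
  have hm : memory τ (fun s => ⟪mulOp _ hla (extendLeft τ u s), extendLeft τ u s⟫) 0
      ≤ ∫ _ in (-τ)..0, ‖mulOp _ hla‖ * K ^ 2 := by
    rw [memory, zero_sub]
    refine intervalIntegral.integral_mono_on (by linarith)
      (by apply Continuous.intervalIntegrable; fun_prop)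
      (by simp) fun s hs => ?_
    have h1 : Real.exp (-(0 - s)) ≤ 1 := Real.exp_le_one_iff.2 (by linarith [hs.2])
    have h2 : ⟪mulOp _ hla (extendLeft τ u s), extendLeft τ u s⟫ ≤ ‖mulOp _ hla‖ * K ^ 2 :=
      calc ⟪mulOp _ hla (extendLeft τ u s), extendLeft τ u s⟫
          ≤ ‖mulOp _ hla (extendLeft τ u s)‖ * ‖extendLeft τ u s‖ := real_inner_le_norm _ _
        _ ≤ ‖mulOp _ hla‖ * ‖extendLeft τ u s‖ * ‖extendLeft τ u s‖ := by
            gcongr; exact (mulOp _ hla).le_opNorm _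
        _ = ‖mulOp _ hla‖ * ‖extendLeft τ u s‖ ^ 2 := by ring
        _ ≤ ‖mulOp _ hla‖ * K ^ 2 := by gcongr; exact hle s hs
    calc _ ≤ 1 * ⟪mulOp _ hla (extendLeft τ u s), extendLeft τ u s⟫ :=
          mul_le_mul_of_nonneg_right h1 (inner_mulOp_abs_nonneg hla _)
      _ ≤ _ := by rw [one_mul]; exact h2
  rw [intervalIntegral.integral_const, smul_eq_mul] at hm
  rw [h.initialConst_eq hla hτ]
  linarith

end Solution

/-- The potential is absorbed by the dissipation up to the constant of the decay rate. -/
theorem integral_potential_mul_sq_le {p : ℝ} (hp : 1 ≤ p) {b β v v' : ℝ → ℝ}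
    (hβ : MemLp β (ENNReal.ofReal p) volume) (hb : MemLp b ⊤ volume) (hbβ : ∀ᵐ x : ℝ, b x ≤ β x)
    (hv : ∀ x, HasDerivAt v (v' x) x) (h : MemLp v 2 volume) (h' : MemLp v' 2 volume) :
    ∫ x, b x * v x ^ 2 ≤ (∫ x, v' x ^ 2) + (2 * p - 1) / (2 * p) * (2 / p) ^ (1 / (2 * p - 1)) *
        normLp p β ^ (2 * p / (2 * p - 1)) * ∫ x, v x ^ 2 := by
  have hg := integral_abs_mul_sq_le hp hβ hv h h'
  -- The bound `b ≤ β` is one-sided; since `v² ≥ 0`, passing to `β ≤ |β|` suffices.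
  refine le_trans (integral_mono_ae ?_ hg.1 ?_) hg.2
  · have h1 : MemLp (fun x => v x ^ 2) 1 volume := memLp_one_iff_integrable.2 h.integrable_sq
    exact hb.integrable_mul h1
  · filter_upwards [hbβ] with x hx
    exact mul_le_mul_of_nonneg_right (hx.trans (le_abs_self _)) (sq_nonneg _)

end

end DelayedKdVBurgers

open DelayedKdVBurgers
theorem theorem2p3 (τ : ℝ) (hτ : 0 < τ) (l₀ l : ℝ → ℝ)
    (hl₀ : MemLp l₀ ⊤ volume) (hl : MemLp l ⊤ volume)
    (α₀ : ℝ) (hα₀ : 0 < α₀) (hl₀α₀ : ∀ᵐ x : ℝ, α₀ ≤ l₀ x)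
    (p : ℝ) (hp : 1 ≤ p) (α : ℝ) (β : ℝ → ℝ) (hβ : MemLp β (ENNReal.ofReal p) volume)
    (hlβ : ∀ᵐ x : ℝ, (Real.exp τ + 1) / 2 * |l x| ≤ α + β x)
    (hα : 0 ≤ α) (hαα₀ : α < α₀)
    (hβα : normLp p β < ((α₀ - α) / cConst p) ^ (1 - 1 / (2 * p))) :
    IsExponentiallyStable τ l₀ l ∧
    0 < decayRate p α₀ α β ∧
    ∀ u₀ u : ℝ → L2, ContinuousOn u₀ (Icc (-τ) 0) → IsSolution τ l₀ l u₀ u →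
      ∀ t : ℝ, 0 ≤ t →
        lyapunov τ l u t ≤ lyapunov τ l u 0 * Real.exp (-decayRate p α₀ α β * t) ∧
        lyapunov τ l u t ≤ initialConst τ l u₀ * Real.exp (-decayRate p α₀ α β * t) := by
  have hla : MemLp (fun x => |l x|) ⊤ volume := hl.abs
  have hb : MemLp (fun x => (Real.exp τ + 1) / 2 * |l x| - α) ⊤ volume :=
    (hla.const_mul _).sub (memLp_top_const α)
  have hbβ : ∀ᵐ x : ℝ, (Real.exp τ + 1) / 2 * |l x| - α ≤ β x := by
    filter_upwards [hlβ] with x hx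
    linarith
  have hγ : 0 < decayRate p α₀ α β :=
    lt_min (mul_pos two_pos (decayRate_pos hp hαα₀ hβα)) one_pos
  have hdecay : ∀ u₀ u : ℝ → L2, IsSolution τ l₀ l u₀ u → ∀ t : ℝ, 0 ≤ t →
      lyapunov τ l u t ≤ lyapunov τ l u 0 * Real.exp (-decayRate p α₀ α β * t) ∧
      lyapunov τ l u t ≤ initialConst τ l u₀ * Real.exp (-decayRate p α₀ α β * t) := by
    intro u₀ u hu t ht
    have h1 : lyapunov τ l u t ≤ lyapunov τ l u 0 * Real.exp (-decayRate p α₀ α β * t) :=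
      hu.lyapunov_le hτ hl₀ hl hl₀α₀
        (fun v v' hv h h' => integral_potential_mul_sq_le hp hβ hb hbβ hv h h') ht
    exact ⟨h1, h1.trans (mul_le_mul_of_nonneg_right (hu.lyapunov_zero_le hτ hl)
      (Real.exp_pos _).le)⟩
  -- The energy controls `½ ‖u‖²`, so taking square roots halves the rate and puts the root on the
  -- constant of `initialConst_le`.
  refine ⟨⟨√(1 + 2 * τ * ‖mulOp _ hla‖), Real.sqrt_pos.2 (by positivity),
    decayRate p α₀ α β / 2, half_pos hγ, fun u₀ u _ hu K hK t ht => ?_⟩, hγ,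
    fun u₀ u _ hu => hdecay u₀ u hu⟩
  have hK0 : 0 ≤ K := (norm_nonneg _).trans (hK 0 (right_mem_Icc.2 (by linarith)))
  have h1 := half_norm_sq_le_lyapunov (u := u) hl hτ ht
  have h2 := (hdecay u₀ u hu t ht).2
  have h3 := mul_le_mul_of_nonneg_right (hu.initialConst_le hτ hla hK)
    (Real.exp_pos (-decayRate p α₀ α β * t)).le
  have h4 : Real.exp (-(decayRate p α₀ α β / 2) * t) ^ 2 = Real.exp (-decayRate p α₀ α β * t) := by
    rw [← Real.exp_nat_mul]
    congr 1
    push_cast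
    ring
  refine (pow_le_pow_iff_left₀ (norm_nonneg _) (by positivity) two_ne_zero).1 ?_
  rw [mul_pow, mul_pow, Real.sq_sqrt (by positivity), h4]
  linarith
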